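/- Order the additive group $\mathbb{Z}^2$ lexicographically with priority on the second coordinate, and let $$M=(\mathbb{N}_0\times\{0\})\cup(\mathbb{Z}\times\mathbb{N}_{>0})$$ be its nonnegative cone. Let $\mathbb{Q}[x;M]$ be the monoid ring of $M$ over $\mathbb{Q}$, that is, the ring of polynomial expressions with rational coefficients and exponents in $M$. Then $\mathbb{Q}[x;M]$ is an integral domain that is Furstenberg (every nonzero nonunit is divisible by an irreducible element) and a GCD-domain, but it is not atomic (some nonzero nonunit is not a finite product of irreducible elements), and it is not a UFD. In particular, let a semidomain be a subsemiring of an integral domain. Then it is not true that, for every semidomain $S$, the multiplicative monoid $S\setminus\{0\}$ is a unique factorization monoid if and only if it is a Furstenberg GCD-monoid. That is, the characterization of unique factorization semidomains (UFSs) as the quasi-atomic GCD-semidomains fails if "quasi-atomic" is replaced by "Furstenberg". (Here $S$ is quasi-atomic if for every nonzero nonunit $b\in S$ there is a nonzero $c\in S$ such that $bc$ is a finite product of irreducible elements.) -/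

import Mathlib

/-- A semidomain: a commutative semiring which is (isomorphic to) a subsemiring of an integral
domain. -/
def IsSemidomain.{u} (S : Type u) [CommSemiring S] : Prop :=
  ∃ (R : Type u) (_ : CommRing R) (_ : IsDomain R) (f : S →+* R), Function.Injective f

/-- `S` is Furstenberg: every nonzero nonunit is divisible by an atom. -/
def IsFurstenberg (S : Type*) [CommMonoidWithZero S] : Prop :=
  ∀ b : S, b ≠ 0 → ¬ IsUnit b → ∃ a : S, Irreducible a ∧ a ∣ b

/-- `S` is atomic: every nonzero nonunit is a finite product of atoms. -/
def IsAtomicMul (S : Type*) [CommMonoidWithZero S] : Prop :=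
  ∀ b : S, b ≠ 0 → ¬ IsUnit b →
    ∃ s : Multiset S, (∀ a ∈ s, Irreducible a) ∧ s.prod = b

/-- The nonnegative cone of `ℤ²` under the lexicographic order with priority on the second
coordinate; `ℤ ×ₗ ℤ` gives priority to the first one, hence the swap. -/
def lexCone : AddSubmonoid (ℤ × ℤ) where
  carrier := {p | 0 ≤ toLex (p.2, p.1)}
  zero_mem' := le_refl (0 : ℤ ×ₗ ℤ)
  add_mem' {p q} hp hq := by
    have h : (0 : ℤ ×ₗ ℤ) ≤ toLex (p.2, p.1) + toLex (q.2, q.1) := add_nonneg hp hq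
    exact h

theorem mem_lexCone_iff (p : ℤ × ℤ) :
    p ∈ lexCone ↔ (0 ≤ p.1 ∧ p.2 = 0) ∨ 0 < p.2 := by
  have h : p ∈ lexCone ↔ toLex ((0 : ℤ), (0 : ℤ)) ≤ toLex (p.2, p.1) := Iff.rfl
  rw [h, Prod.Lex.toLex_le_toLex]
  simp only
  omega

/-!
The ring `ℚ[M]` is studied inside the Laurent polynomial ring `T = ℚ[ℤ²]`, which is a unique
factorization domain because it is an iterated Laurent polynomial ring over a field. Let `v f` be the
smallest exponent of `f ≠ 0` in the lexicographic order. Since the order is compatible with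
addition, `v (f * g) = v f + v g`, and `ℚ[M]` consists of `0` and the `f` with `0 ≤ v f`. Moreover
the monomials are units of `T`, so units of `T` take every value. Hence, for nonzero elements
of `ℚ[M]`, divisibility means divisibility in `T` together with `v a ≤ v b`
(`IsNonnegPart.dvd_iff`), and the units are the units of `T` of value `0`
(`IsNonnegPart.isUnit_iff`).

* GCD: multiply a gcd in `T` of `a` and `b` by a unit so that its value becomes `min (v a) (v b)`
  (`IsNonnegPart.isGCDMonoid`).
* Furstenberg: the value group has a least positive element `π`, and a unit `x` of `T` of
  value `π` is irreducible in `ℚ[M]`; it divides every element of positive value. A nonunit of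
  value `0` is divisible by one of its irreducible factors in `T`, rescaled to have value `0`
  (`IsNonnegPart.isFurstenberg`).
* Not atomic: an irreducible element dividing a unit of `T` is associated to `x`, so has value `π`.
  Thus a monomial whose exponent is not a multiple of `π = (1, 0)`, such as the one with
  exponent `(0, 1)`, is not a product of irreducible elements (`IsNonnegPart.not_isAtomicMul`).
-/

/-! ### Subrings of elements of nonnegative value -/

/-- `φ` embeds `R` into `T` as the elements of nonnegative value, where `v` is a map that is
additive on products of nonzero elements and takes every value on units. The value `v 0` is
irrelevant. -/
structure IsNonnegPart {R T Γ : Type*} [CommRing R] [CommRing T] [AddCommGroup Γ] [LinearOrder Γ]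
    (φ : R →+* T) (v : T → Γ) : Prop where
  injective : Function.Injective φ
  map_mul : ∀ f g : T, f ≠ 0 → g ≠ 0 → v (f * g) = v f + v g
  exists_isUnit : ∀ γ : Γ, ∃ u : T, IsUnit u ∧ v u = γ
  nonneg : ∀ r : R, r ≠ 0 → 0 ≤ v (φ r)
  exists_eq : ∀ f : T, f ≠ 0 → 0 ≤ v f → ∃ r : R, φ r = f

namespace IsNonnegPart

variable {R T Γ : Type*} [CommRing R] [CommRing T] [AddCommGroup Γ] [LinearOrder Γ]
  {φ : R →+* T} {v : T → Γ}

theorem map_ne_zero (h : IsNonnegPart φ v) {r : R} (hr : r ≠ 0) : φ r ≠ 0 :=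
  (map_ne_zero_iff φ h.injective).2 hr

theorem dvd_iff [IsOrderedAddMonoid Γ] (h : IsNonnegPart φ v) {a b : R} (ha : a ≠ 0) (hb : b ≠ 0) :
    a ∣ b ↔ φ a ∣ φ b ∧ v (φ a) ≤ v (φ b) := by
  constructor
  · rintro ⟨c, rfl⟩
    have hc : c ≠ 0 := right_ne_zero_of_mul hb
    refine ⟨map_dvd φ (dvd_mul_right a c), ?_⟩
    rw [_root_.map_mul, h.map_mul _ _ (h.map_ne_zero ha) (h.map_ne_zero hc)]
    exact le_add_of_nonneg_right (h.nonneg c hc)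
  · rintro ⟨⟨c, hc⟩, hle⟩
    have hc0 : c ≠ 0 := by
      rintro rfl
      exact h.map_ne_zero hb (by simpa using hc)
    rw [hc, h.map_mul _ _ (h.map_ne_zero ha) hc0] at hle
    obtain ⟨r, rfl⟩ := h.exists_eq c hc0 (le_add_iff_nonneg_right _ |>.1 hle)
    exact ⟨r, h.injective (by rw [hc, _root_.map_mul])⟩

variable [IsDomain T]

theorem map_one (h : IsNonnegPart φ v) : v 1 = 0 := by
  simpa using h.map_mul 1 1 one_ne_zero one_ne_zero

/-- Every element can be rescaled by a unit to have any prescribed value. -/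
theorem exists_associated (h : IsNonnegPart φ v) {f : T} (hf : f ≠ 0) (γ : Γ) :
    ∃ g : T, Associated f g ∧ v g = γ := by
  obtain ⟨u, hu, hv⟩ := h.exists_isUnit (γ - v f)
  refine ⟨f * u, associated_mul_unit_right f u hu, ?_⟩
  rw [h.map_mul f u hf hu.ne_zero, hv, add_sub_cancel]

theorem exists_isUnit_map (h : IsNonnegPart φ v) {γ : Γ} (hγ : 0 ≤ γ) :
    ∃ x : R, x ≠ 0 ∧ IsUnit (φ x) ∧ v (φ x) = γ := by
  obtain ⟨u, hu, hv⟩ := h.exists_isUnit γ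
  obtain ⟨x, rfl⟩ := h.exists_eq u hu.ne_zero (hv ▸ hγ)
  refine ⟨x, ?_, hu, hv⟩
  rintro rfl
  exact hu.ne_zero (map_zero φ)

variable [IsOrderedAddMonoid Γ]

theorem isUnit_iff (h : IsNonnegPart φ v) {a : R} (ha : a ≠ 0) :
    IsUnit a ↔ IsUnit (φ a) ∧ v (φ a) = 0 := by
  have : Nontrivial R := ⟨a, 0, ha⟩
  rw [isUnit_iff_dvd_one, h.dvd_iff ha one_ne_zero, _root_.map_one, ← isUnit_iff_dvd_one, h.map_one]
  exact and_congr_right fun _ => ⟨fun h' => h'.antisymm (h.nonneg a ha), le_of_eq⟩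

theorem isGCDMonoid (h : IsNonnegPart φ v) [IsDomain R] [IsGCDMonoid T] : IsGCDMonoid R := by
  refine isGCDMonoid_iff_exists_gcd.2 ⟨inferInstance, fun a b => ?_⟩
  rcases eq_or_ne a 0 with rfl | ha
  · exact ⟨b, fun d => by simp⟩
  rcases eq_or_ne b 0 with rfl | hb
  · exact ⟨a, fun d => by simp⟩
  obtain ⟨c, hc⟩ := (isGCDMonoid_iff_exists_gcd.1 ‹IsGCDMonoid T›).2 (φ a) (φ b)
  have hc0 : c ≠ 0 := by
    rintro rfl
    exact h.map_ne_zero ha (zero_dvd_iff.1 ((hc 0).2 dvd_rfl).1)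
  -- The value `min (v a) (v b)` is the largest one compatible with dividing both `a` and `b`.
  obtain ⟨g, hg, hvg⟩ := h.exists_associated hc0 (min (v (φ a)) (v (φ b)))
  have hg0 : g ≠ 0 := fun h0 => hc0 (hg.eq_zero_iff.2 h0)
  obtain ⟨r, rfl⟩ := h.exists_eq g hg0 (hvg ▸ le_min (h.nonneg a ha) (h.nonneg b hb))
  have hr : r ≠ 0 := by
    rintro rfl
    exact hg0 (map_zero φ)
  refine ⟨r, fun d => ?_⟩
  rcases eq_or_ne d 0 with rfl | hd
  · simp [ha, hr]
  rw [h.dvd_iff hd ha, h.dvd_iff hd hb, h.dvd_iff hd hr, ← hg.dvd_iff_dvd_right, ← hc, hvg,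
    le_min_iff]
  tauto

/-- In a factorization of `x` both values are nonnegative and add up to `π`, so one of them is `0`
because no value lies strictly between `0` and `π`. -/
theorem irreducible_of_isUnit_map (h : IsNonnegPart φ v) {π : Γ} (hπ : 0 < π)
    (hleast : ∀ γ : Γ, 0 < γ → π ≤ γ) {x : R} (hx0 : x ≠ 0) (hx : IsUnit (φ x))
    (hvx : v (φ x) = π) : Irreducible x := by
  refine ⟨fun hu => hπ.ne' (hvx ▸ ((h.isUnit_iff hx0).1 hu).2), ?_⟩
  rintro s t rfl
  have hs := left_ne_zero_of_mul hx0
  have ht := right_ne_zero_of_mul hx0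
  rw [_root_.map_mul] at hx hvx
  rw [h.map_mul _ _ (h.map_ne_zero hs) (h.map_ne_zero ht)] at hvx
  rcases (h.nonneg s hs).eq_or_lt with h0 | hpos
  · exact .inl ((h.isUnit_iff hs).2 ⟨isUnit_of_mul_isUnit_left hx, h0.symm⟩)
  · refine .inr ((h.isUnit_iff ht).2 ⟨isUnit_of_mul_isUnit_right hx, ?_⟩)
    refine le_antisymm (le_of_add_le_add_left (a := v (φ s)) ?_) (h.nonneg t ht)
    rw [hvx, add_zero]
    exact hleast _ hpos

/-- An element of value `0` that is irreducible in `T` stays irreducible in `R`. -/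
theorem irreducible_of_irreducible_map (h : IsNonnegPart φ v) {p : R} (hp : Irreducible (φ p))
    (hvp : v (φ p) = 0) : Irreducible p := by
  refine ⟨fun hu => hp.not_isUnit (hu.map φ), ?_⟩
  rintro s t rfl
  have hst : s * t ≠ 0 := by
    intro h0
    exact hp.ne_zero (by rw [h0, map_zero])
  have hs := left_ne_zero_of_mul hst
  have ht := right_ne_zero_of_mul hst
  rw [_root_.map_mul] at hp hvp
  rw [h.map_mul _ _ (h.map_ne_zero hs) (h.map_ne_zero ht)] at hvp
  obtain ⟨hvs, hvt⟩ := (add_eq_zero_iff_of_nonneg (h.nonneg s hs) (h.nonneg t ht)).1 hvp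
  exact (hp.isUnit_or_isUnit rfl).imp (fun hu => (h.isUnit_iff hs).2 ⟨hu, hvs⟩)
    fun hu => (h.isUnit_iff ht).2 ⟨hu, hvt⟩

theorem isFurstenberg (h : IsNonnegPart φ v) [WfDvdMonoid T] {π : Γ} (hπ : 0 < π)
    (hleast : ∀ γ : Γ, 0 < γ → π ≤ γ) : IsFurstenberg R := by
  intro b hb hbu
  rcases (h.nonneg b hb).eq_or_lt with h0 | hpos
  · have hbu' : ¬ IsUnit (φ b) := fun hu => hbu ((h.isUnit_iff hb).2 ⟨hu, h0.symm⟩)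
    obtain ⟨p, hp, hpb⟩ := WfDvdMonoid.exists_irreducible_factor hbu' (h.map_ne_zero hb)
    obtain ⟨q, hpq, hvq⟩ := h.exists_associated hp.ne_zero 0
    have hq := hpq.irreducible hp
    obtain ⟨r, rfl⟩ := h.exists_eq q hq.ne_zero hvq.ge
    have hr := h.irreducible_of_irreducible_map hq hvq
    refine ⟨r, hr, (h.dvd_iff ?_ hb).2 ⟨hpq.symm.dvd.trans hpb, by rw [hvq, ← h0]⟩⟩
    rintro rfl
    exact hq.ne_zero (map_zero φ)
  · obtain ⟨x, hx0, hx, hvx⟩ := h.exists_isUnit_map hπ.le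
    exact ⟨x, h.irreducible_of_isUnit_map hπ hleast hx0 hx hvx,
      (h.dvd_iff hx0 hb).2 ⟨hx.dvd, hvx ▸ hleast _ hpos⟩⟩

/-- Such an `a` is divisible by an element `x` of value `π` that is a unit of `T`. Both are
irreducible, so they are associated. -/
theorem map_eq_of_irreducible_of_isUnit_map (h : IsNonnegPart φ v) {π : Γ} (hπ : 0 < π)
    (hleast : ∀ γ : Γ, 0 < γ → π ≤ γ) {a : R} (ha0 : a ≠ 0) (ha : Irreducible a)
    (hua : IsUnit (φ a)) : v (φ a) = π := by
  have hpos : 0 < v (φ a) := (h.nonneg a ha0).lt_of_ne' fun h0 =>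
    ha.not_isUnit ((h.isUnit_iff ha0).2 ⟨hua, h0⟩)
  obtain ⟨x, hx0, hx, hvx⟩ := h.exists_isUnit_map hπ.le
  have hxa : x ∣ a := (h.dvd_iff hx0 ha0).2 ⟨hx.dvd, hvx ▸ hleast _ hpos⟩
  have hax : a ∣ x :=
    ((h.irreducible_of_isUnit_map hπ hleast hx0 hx hvx).associated_of_dvd ha hxa).symm.dvd
  exact le_antisymm (hvx ▸ ((h.dvd_iff ha0 hx0).1 hax).2) (hleast _ hpos)

/-- A product of irreducible elements that is a unit of `T` has a value that is a multiple of the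
least positive value. -/
theorem map_multiset_prod (h : IsNonnegPart φ v) [Nontrivial R] {π : Γ} (hπ : 0 < π)
    (hleast : ∀ γ : Γ, 0 < γ → π ≤ γ) (s : Multiset R) (hs : ∀ a ∈ s, Irreducible a)
    (hu : IsUnit (φ s.prod)) : v (φ s.prod) = s.card • π := by
  induction s using Multiset.induction with
  | empty => simpa using h.map_one
  | cons a s ih =>
    rw [Multiset.prod_cons, _root_.map_mul] at hu ⊢
    have hua := isUnit_of_mul_isUnit_left hu
    have hus := isUnit_of_mul_isUnit_right hu
    have ha := hs a (Multiset.mem_cons_self a s)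
    rw [h.map_mul _ _ hua.ne_zero hus.ne_zero,
      h.map_eq_of_irreducible_of_isUnit_map hπ hleast ha.ne_zero ha hua,
      ih (fun b hb => hs b (Multiset.mem_cons_of_mem hb)) hus, Multiset.card_cons, succ_nsmul']

theorem not_isAtomicMul (h : IsNonnegPart φ v) [Nontrivial R] {π γ : Γ} (hπ : 0 < π)
    (hleast : ∀ γ : Γ, 0 < γ → π ≤ γ) (hγ : 0 < γ) (hne : ∀ n : ℕ, n • π ≠ γ) :
    ¬ IsAtomicMul R := by
  intro hR
  obtain ⟨y, hy0, hy, hvy⟩ := h.exists_isUnit_map hγ.le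
  obtain ⟨s, hs, rfl⟩ := hR y hy0 fun hu => hγ.ne' (hvy ▸ ((h.isUnit_iff hy0).1 hu).2)
  exact hne s.card (hvy ▸ (h.map_multiset_prod hπ hleast s hs hy).symm)

end IsNonnegPart

theorem UniqueFactorizationMonoid.isAtomicMul (S : Type*) [CommMonoidWithZero S]
    [UniqueFactorizationMonoid S] : IsAtomicMul S := fun b hb hu =>
  let ⟨s, hs, hprod, _⟩ := (WfDvdMonoid.not_isUnit_iff_exists_factors_eq b hb).1 hu
  ⟨s, hs, hprod⟩

/-! ### Unique factorization of Laurent polynomials -/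

instance LaurentPolynomial.uniqueFactorizationMonoid (D : Type*) [CommRing D] [IsDomain D]
    [UniqueFactorizationMonoid D] : UniqueFactorizationMonoid (LaurentPolynomial D) :=
  .of_isLocalization (Submonoid.powers (Polynomial.X : Polynomial D)) _

/-- `K[ℤ²]` is the ring of Laurent polynomials over the Laurent polynomials over `K`. -/
instance AddMonoidAlgebra.uniqueFactorizationMonoid_int_prod (K : Type*) [Field K] :
    UniqueFactorizationMonoid (AddMonoidAlgebra K (ℤ × ℤ)) :=
  (AddMonoidAlgebra.curryRingEquiv (R := K) (M := ℤ) (N := ℤ)).symm.toMulEquiv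
    |>.uniqueFactorizationMonoid
      (LaurentPolynomial.uniqueFactorizationMonoid (LaurentPolynomial K))

/-! ### The lowest exponent -/

namespace AddMonoidAlgebra

section LowestExponent

variable {K A Γ : Type*} [Field K] [AddCommGroup A] [AddCommGroup Γ] [LinearOrder Γ]

/-- The least value `D a` over the exponents `a` of `f`, with the junk value `0` at `f = 0`. -/
noncomputable def lowestExponent (D : A → Γ) (f : AddMonoidAlgebra K A) : Γ :=
  if h : f.coeff.support.Nonempty then f.coeff.support.inf' h D else 0

theorem support_coeff_nonempty {f : AddMonoidAlgebra K A} (hf : f ≠ 0) :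
    f.coeff.support.Nonempty := by
  simpa [Finsupp.support_nonempty_iff] using hf

theorem le_lowestExponent_iff {D : A → Γ} {f : AddMonoidAlgebra K A} (hf : f ≠ 0) {γ : Γ} :
    γ ≤ lowestExponent D f ↔ ∀ a ∈ f.coeff.support, γ ≤ D a := by
  rw [lowestExponent, dif_pos (support_coeff_nonempty hf), Finset.le_inf'_iff]

theorem exists_mem_support_lowestExponent (D : A → Γ) {f : AddMonoidAlgebra K A} (hf : f ≠ 0) :
    ∃ a ∈ f.coeff.support, lowestExponent D f = D a := by
  rw [lowestExponent, dif_pos (support_coeff_nonempty hf)]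
  exact Finset.exists_mem_eq_inf' _ D

theorem lowestExponent_single (D : A → Γ) (a : A) {r : K} (hr : r ≠ 0) :
    lowestExponent D (single a r) = D a := by
  obtain ⟨b, hb, h⟩ := exists_mem_support_lowestExponent D (f := single a r) (by simpa using hr)
  rw [coeff_single, Finsupp.mem_support_single] at hb
  rw [h, hb.1]

variable [IsOrderedAddMonoid Γ]

/-- The exponent of least value in a product is attained only once, by the sum of the exponents of
least value, so its coefficient does not cancel. -/
theorem lowestExponent_mul {D : A →+ Γ} (hD : Function.Injective D) {f g : AddMonoidAlgebra K A}
    (hf : f ≠ 0) (hg : g ≠ 0) :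
    lowestExponent D (f * g) = lowestExponent D f + lowestExponent D g := by
  classical
  obtain ⟨a, ha, hfa⟩ := exists_mem_support_lowestExponent D hf
  obtain ⟨b, hb, hgb⟩ := exists_mem_support_lowestExponent D hg
  have hfle := (le_lowestExponent_iff hf).1 hfa.ge
  have hgle := (le_lowestExponent_iff hg).1 hgb.ge
  have huniq : UniqueAdd f.coeff.support g.coeff.support a b := by
    intro a' b' ha' hb' hab
    have h := congrArg D hab
    rw [map_add, map_add] at h
    obtain ⟨h1, h2⟩ := (add_eq_add_iff_eq_and_eq (hfle a' ha') (hgle b' hb')).1 h.symm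
    exact ⟨hD h1.symm, hD h2.symm⟩
  have hcoeff : (f * g).coeff (a + b) ≠ 0 := by
    rw [coeff_mul_add_of_uniqueAdd huniq]
    exact mul_ne_zero (Finsupp.mem_support_iff.1 ha) (Finsupp.mem_support_iff.1 hb)
  have hfg : f * g ≠ 0 := by
    intro h0
    simp [h0] at hcoeff
  rw [hfa, hgb, ← map_add]
  refine le_antisymm ((le_lowestExponent_iff hfg).1 le_rfl _ (Finsupp.mem_support_iff.2 hcoeff))
    ((le_lowestExponent_iff hfg).2 fun c hc => ?_)
  obtain ⟨a', ha', b', hb', rfl⟩ := Finset.mem_add.1 (support_coeff_mul_subset f g hc)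
  rw [map_add, map_add]
  exact add_le_add (hfle a' ha') (hgle b' hb')

theorem isNonnegPart_mapDomainRingHom {D : A →+ Γ} (hD : Function.Bijective D)
    (S : AddSubmonoid A) (hS : ∀ a, a ∈ S ↔ 0 ≤ D a) :
    IsNonnegPart (mapDomainRingHom K S.subtype) (lowestExponent D) where
  injective := mapDomain_injective Subtype.val_injective
  map_mul _ _ hf hg := lowestExponent_mul hD.1 hf hg
  exists_isUnit γ := by
    obtain ⟨a, rfl⟩ := hD.2 γ
    refine ⟨single a 1, .of_mul_eq_one (single (-a) 1) ?_, lowestExponent_single _ _ one_ne_zero⟩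
    rw [single_mul_single, add_neg_cancel, mul_one, one_def]
  nonneg r hr := by
    classical
    refine (le_lowestExponent_iff ?_).2 fun a ha => ?_
    · exact (map_ne_zero_iff _ (mapDomain_injective Subtype.val_injective)).2 hr
    · obtain ⟨s, -, rfl⟩ := Finset.mem_image.1 (Finsupp.mapDomain_support ha)
      exact (hS s).1 s.2
  exists_eq f hf h := by
    have hsub : ↑f.coeff.support ⊆ Set.range (Subtype.val : S → A) := fun a ha => by
      rw [Subtype.range_val]
      exact (hS a).2 ((le_lowestExponent_iff hf).1 h a ha)
    refine ⟨ofCoeff (f.coeff.comapDomain Subtype.val Subtype.val_injective.injOn), ?_⟩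
    exact coeff_injective (Finsupp.mapDomain_comapDomain _ Subtype.val_injective _ hsub)

end LowestExponent

end AddMonoidAlgebra

/-! ### The lexicographic cone in `ℤ²` -/

/-- The identification of `ℤ²` with `ℤ ×ₗ ℤ` that swaps the coordinates, so that the
second coordinate has priority. -/
def lexSwap : ℤ × ℤ →+ ℤ ×ₗ ℤ where
  toFun p := toLex (p.2, p.1)
  map_zero' := rfl
  map_add' _ _ := rfl

theorem lexSwap_bijective : Function.Bijective lexSwap :=
  toLex.bijective.comp Prod.swap_bijective

theorem isNonnegPart_lexCone :
    IsNonnegPart (AddMonoidAlgebra.mapDomainRingHom ℚ lexCone.subtype)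
      (AddMonoidAlgebra.lowestExponent lexSwap) :=
  AddMonoidAlgebra.isNonnegPart_mapDomainRingHom lexSwap_bijective lexCone fun _ => Iff.rfl

/-! The least positive value is `toLex (0, 1) = lexSwap (1, 0)`, and `toLex (1, 0) = lexSwap (0, 1)`
is a positive value that is not a multiple of it. -/

theorem toLex_zero_one_pos : (0 : ℤ ×ₗ ℤ) < toLex (0, 1) :=
  Prod.Lex.toLex_lt_toLex.2 (by simp)

theorem toLex_zero_one_le_of_pos (γ : ℤ ×ₗ ℤ) (h : 0 < γ) : toLex (0, 1) ≤ γ := by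
  obtain ⟨⟨a, b⟩, rfl⟩ := toLex.surjective γ
  have h' : toLex ((0 : ℤ), (0 : ℤ)) < toLex (a, b) := h
  rw [Prod.Lex.toLex_lt_toLex] at h'
  rw [Prod.Lex.toLex_le_toLex]
  simp only at h' ⊢
  omega

theorem nsmul_toLex_zero_one_ne (n : ℕ) : n • toLex ((0 : ℤ), (1 : ℤ)) ≠ toLex (1, 0) := by
  intro h
  have h' : n • ((0 : ℤ), (1 : ℤ)) = (1, 0) := congrArg ofLex h
  simp at h'

theorem mainTheorem11 :
    IsDomain (AddMonoidAlgebra ℚ lexCone) ∧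
    IsFurstenberg (AddMonoidAlgebra ℚ lexCone) ∧
    IsGCDMonoid (AddMonoidAlgebra ℚ lexCone) ∧
    ¬ IsAtomicMul (AddMonoidAlgebra ℚ lexCone) ∧
    ¬ UniqueFactorizationMonoid (AddMonoidAlgebra ℚ lexCone) ∧
    ¬ (∀ (S : Type) [CommSemiring S], IsSemidomain S →
        (UniqueFactorizationMonoid S ↔ IsFurstenberg S ∧ IsGCDMonoid S)) := by
  have hdom : IsDomain (AddMonoidAlgebra ℚ lexCone) :=
    isNonnegPart_lexCone.injective.isDomain _
  have hF : IsFurstenberg (AddMonoidAlgebra ℚ lexCone) :=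
    isNonnegPart_lexCone.isFurstenberg toLex_zero_one_pos toLex_zero_one_le_of_pos
  have hG : IsGCDMonoid (AddMonoidAlgebra ℚ lexCone) := isNonnegPart_lexCone.isGCDMonoid
  have hA : ¬ IsAtomicMul (AddMonoidAlgebra ℚ lexCone) :=
    isNonnegPart_lexCone.not_isAtomicMul toLex_zero_one_pos toLex_zero_one_le_of_pos
      (Prod.Lex.toLex_lt_toLex.2 (by simp)) nsmul_toLex_zero_one_ne
  have hU : ¬ UniqueFactorizationMonoid (AddMonoidAlgebra ℚ lexCone) := fun _ =>
    hA (UniqueFactorizationMonoid.isAtomicMul _)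
  exact ⟨hdom, hF, hG, hA, hU, fun hall =>
    hU ((hall _ ⟨_, inferInstance, hdom, RingHom.id _, Function.injective_id⟩).2 ⟨hF, hG⟩)⟩
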